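/- All dimensions below take values in $[-1,\infty]$ and equal $-1$ for the empty space. $\dim_H$ denotes Hausdorff dimension, and $\dim_t$ denotes the small inductive topological dimension. For a metric space $X$ and $n\in\mathbb N$ the $n$th inductive topological Hausdorff dimension is defined by $\dim_{t^nH}\emptyset=-1$ and, for $X\neq\emptyset$, by $\dim_{t^0H}X=\dim_H X$ and, for $n\ge 1$, $$\dim_{t^nH}X=\inf\{d: X\text{ has a basis }\mathcal U\text{ such that }\dim_{t^{n-1}H}\partial U\le d-1\text{ for every }U\in\mathcal U\},$$ where $d$ ranges over the real numbers together with $\infty$ and $\infty-1=\infty$. A set $L\subseteq X$ is a partition between disjoint sets $A,B\subseteq X$ if $L=X\setminus(U\cup V)$ for some disjoint open sets $U\supseteq A$ and $V\supseteq B$. For $s>0$ let $\mathcal H^s_\infty(A)=\inf\{\sum_{i=1}^\infty(\operatorname{diam}U_i)^s: A\subseteq\bigcup_{i=1}^\infty U_i\}$ be the $s$-Hausdorff content. For a family $\mathcal V$ of sets (repetitions allowed) let $T_m(\mathcal V)$ be the set of points covered by at least $m$ members of $\mathcal V$. A refinement of a cover $\mathcal U$ of $X$ is a cover $\mathcal V$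 of $X$ each of whose members is contained in a member of $\mathcal U$. **Theorem.** Let $n\ge 1$ be an integer and let $X$ be a separable metric space with $\dim_t X\ge n$. Consider the following sets of real numbers $d$, to each of which the element $\infty$ is added: \begin{align*} P_{t^nH}&=\{d: X\text{ has a basis }\mathcal U\text{ such that }\dim_{t^{n-1}H}\partial U\le d-1\text{ for every }U\in\mathcal U\},\\ P_{d^nH}&=\{d\ge n: \text{there is } A\subseteq X\text{ such that }\dim_H A\le d-n\text{ and }\dim_t(X\setminus A)\le n-1\},\\ P_{p^nH}&=\{d\ge n: \text{for all pairs }(A_1,B_1),\dots,(A_n,B_n)\text{ of disjoint closed subsets of }X\\ &\qquad\text{there are partitions }L_i\text{ between }A_i\text{ and }B_i\text{ such that }\textstyle\dim_H\bigl(\bigcap_{i=1}^nL_i\bigr)\le d-n\},\\ P_{c^nH}&=\{d\ge n: \text{for every }\varepsilon>0\text{ and every finite open cover }\mathcal U\text{ of }X\text{ there is a finite open}\\ &\qquad\text{refinement }\mathcal V\text{ of }\mathcal U\text{ such that }\mathcal H^{d-n+\varepsilon}_\infty(T_{n+1}(\mathcal V))\le\varepsilon\}. \end{align*} Then each of these four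 sets has a minimum, and $$\dim_{t^nH}X=\min P_{t^nH}=\min P_{d^nH}=\min P_{p^nH}=\min P_{c^nH}.$$ -/

import Mathlib

open Set TopologicalSpace
open scoped ENNReal

universe u

/-- The (small inductive) topological dimension as an extended real number, with the
convention that the empty space has dimension `-1` (Mathlib's convention is `⊥`). -/
noncomputable def topDim (X : Type u) [TopologicalSpace X] : EReal :=
  WithBot.recBotCoe (-1 : EReal) (fun k : ℕ∞ => ((k : ℝ≥0∞) : EReal)) (smallInductiveDimension X)

open Classical in
/-- The Hausdorff dimension of a subset of a metric space, with the convention that the empty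
set has dimension `-1` (Mathlib's convention is `0`). -/
noncomputable def hausdorffDim {X : Type u} [MetricSpace X] (A : Set X) : EReal :=
  if A = ∅ then -1 else (dimH A : EReal)

open Classical in
/-- The `n`th inductive topological Hausdorff dimension of a metric space. -/
noncomputable def indTopHausdorffDim : ℕ → (X : Type u) → [MetricSpace X] → EReal
  | 0, X, _ => hausdorffDim (univ : Set X)
  | n + 1, X, _ =>
    if IsEmpty X then -1
    else sInf {d : EReal | ∃ 𝓤 : Set (Set X), IsTopologicalBasis 𝓤 ∧
      ∀ U ∈ 𝓤, indTopHausdorffDim n (frontier U) ≤ d - 1}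

/-- The `s`-Hausdorff content of a set (only used for `s > 0`, so that sets of
diameter zero contribute `0`). -/
noncomputable def hausdorffContent {X : Type u} [MetricSpace X] (s : ℝ) (A : Set X) : ℝ≥0∞ :=
  ⨅ (U : ℕ → Set X) (_ : A ⊆ ⋃ i, U i), ∑' i, Metric.ediam (U i) ^ s

/-- `L` is a partition between `A` and `B`. -/
def IsPartitionBetween {X : Type u} [TopologicalSpace X] (A B L : Set X) : Prop :=
  ∃ U V : Set X, IsOpen U ∧ IsOpen V ∧ A ⊆ U ∧ B ⊆ V ∧ U ∩ V = ∅ ∧ L = (U ∪ V)ᶜ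

/-- The indexed family `𝓤` is an open cover of `X`. -/
def IsOpenCoverFamily {X : Type u} [TopologicalSpace X] {ι : Type*} (𝓤 : ι → Set X) : Prop :=
  (∀ i, IsOpen (𝓤 i)) ∧ ⋃ i, 𝓤 i = univ

/-- The set of points covered by at least `m` members of the indexed family `𝓥`
(repeated members are counted with multiplicity). -/
def multiplyCovered {X : Type u} {ι : Type*} (m : ℕ) (𝓥 : ι → Set X) : Set X :=
  {x | (m : ℕ∞) ≤ {i | x ∈ 𝓥 i}.encard}

/-- The parameters `d` (real or `∞`) admitted in the definition of the `n`th inductive topological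
Hausdorff dimension, for `n ≥ 1`. -/
def paramTop (n : ℕ) (X : Type u) [MetricSpace X] : Set EReal :=
  {d | d = ⊤ ∨ ∃ 𝓤 : Set (Set X), IsTopologicalBasis 𝓤 ∧
    ∀ U ∈ 𝓤, indTopHausdorffDim (n - 1) (frontier U) ≤ d - 1}

/-- The decomposition parameters. -/
def paramDecomp (n : ℕ) (X : Type u) [MetricSpace X] : Set EReal :=
  {d | d = ⊤ ∨ ((n : EReal) ≤ d ∧ ∃ A : Set X,
    hausdorffDim A ≤ d - n ∧ topDim (Aᶜ : Set X) ≤ (n : EReal) - 1)}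

/-- The partition parameters. -/
def paramPart (n : ℕ) (X : Type u) [MetricSpace X] : Set EReal :=
  {d | d = ⊤ ∨ ((n : EReal) ≤ d ∧ ∀ A B : Fin n → Set X,
    (∀ i, IsClosed (A i)) → (∀ i, IsClosed (B i)) → (∀ i, A i ∩ B i = ∅) →
    ∃ L : Fin n → Set X, (∀ i, IsPartitionBetween (A i) (B i) (L i)) ∧
      hausdorffDim (⋂ i, L i) ≤ d - n)}

/-- The covering parameters. -/
def paramCover (n : ℕ) (X : Type u) [MetricSpace X] : Set EReal :=
  {d | d = ⊤ ∨ ∃ r : ℝ, d = (r : EReal) ∧ (n : ℝ) ≤ r ∧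
    ∀ ε : ℝ, 0 < ε → ∀ (k : ℕ) (𝓤 : Fin k → Set X), IsOpenCoverFamily 𝓤 →
      ∃ (l : ℕ) (𝓥 : Fin l → Set X), IsOpenCoverFamily 𝓥 ∧ (∀ j, ∃ i, 𝓥 j ⊆ 𝓤 i) ∧
        hausdorffContent (r - n + ε) (multiplyCovered (n + 1) 𝓥) ≤ ENNReal.ofReal ε}

/-!
Writing `d = n + t` with `t ∈ [0, ∞]`, each of the four conditions on `d` turns out to be equivalent
to a decomposition of `X` into a set of Hausdorff dimension at most `t` and `n` zero-dimensional
sets. Such a decomposition restricts to the frontiers of a suitable basis, gives partitions whose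
intersection lies in the small set, and gives refinements made of `n` disjoint families together
with the traces of an open neighbourhood of the small set.

Conversely, each condition implies that `n` pairs of disjoint closed sets always have partitions
whose intersection has arbitrarily small `s`-content, for every `s > t`. Content, unlike Hausdorff
measure, is outer regular. Hence an intersection of small content stays small when the open sets
defining the partitions are enlarged and their closures kept disjoint, and countably many such
requirements can be met in turn by increasing sequences of pairs of open sets. Running through
countably many pairs that separate points from closed sets and all rational `s > t` makes the
intersections null for every `s`-content; their union is the small set of the decomposition.
-/

open MeasureTheory Filter Topology

section Content

/-- An outer measure is open-regular if every set has open supersets of almost the same measure. -/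
def OpenRegular {X : Type*} [TopologicalSpace X] (μ : OuterMeasure X) : Prop :=
  ∀ (A : Set X) (ε : ℝ≥0∞), ε ≠ 0 → ∃ G, IsOpen G ∧ A ⊆ G ∧ μ G ≤ μ A + ε

theorem openRegular_top {X : Type*} [TopologicalSpace X] : OpenRegular (⊤ : OuterMeasure X) := by
  intro A ε _
  rcases A.eq_empty_or_nonempty with rfl | h
  · exact ⟨∅, isOpen_empty, subset_rfl, by simp⟩
  · exact ⟨univ, isOpen_univ, subset_univ _, by simp [OuterMeasure.top_apply h]⟩

/-- The `s`-Hausdorff content as an outer measure; for `s ≤ 0` the empty set is given mass `0` by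
decree, so that only `s > 0` is meaningful. -/
noncomputable def contentMeasure (X : Type*) [MetricSpace X] (s : ℝ) : OuterMeasure X :=
  OuterMeasure.boundedBy fun U => Metric.ediam U ^ s

variable {X : Type*} [MetricSpace X] {s t : ℝ} {A : Set X}

theorem contentMeasure_apply (hs : 0 < s) (A : Set X) :
    contentMeasure X s A = hausdorffContent s A := by
  have h₀ : Metric.ediam (∅ : Set X) ^ s = 0 := by simp [hs]
  rw [contentMeasure, OuterMeasure.boundedBy_eq_ofFunction h₀, OuterMeasure.ofFunction_apply,
    hausdorffContent]

theorem hausdorffContent_le_tsum {U : ℕ → Set X} (h : A ⊆ ⋃ i, U i) :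
    hausdorffContent s A ≤ ∑' i, Metric.ediam (U i) ^ s :=
  iInf₂_le U h

theorem exists_cover_of_hausdorffContent_lt {c : ℝ≥0∞} (h : hausdorffContent s A < c) :
    ∃ U : ℕ → Set X, A ⊆ ⋃ i, U i ∧ ∑' i, Metric.ediam (U i) ^ s < c := by
  simpa only [hausdorffContent, iInf_lt_iff, exists_prop] using h

theorem exists_isOpen_superset_ediam_rpow_le (hs : 0 < s) (A : Set X) {ε : ℝ≥0∞} (hε : ε ≠ 0) :
    ∃ G, IsOpen G ∧ A ⊆ G ∧ Metric.ediam G ^ s ≤ Metric.ediam A ^ s + ε := by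
  by_cases hA : Metric.ediam A = ∞
  · exact ⟨univ, isOpen_univ, subset_univ _, by simp [hA, ENNReal.top_rpow_of_pos hs]⟩
  have hcont : Continuous fun δ : NNReal => (Metric.ediam A + 2 * (δ : ℝ≥0∞)) ^ s :=
    ENNReal.continuous_rpow_const.comp
      (continuous_const.add ((ENNReal.continuous_const_mul (by simp)).comp
        ENNReal.continuous_coe))
  have hlt : (Metric.ediam A + 2 * ((0 : NNReal) : ℝ≥0∞)) ^ s < Metric.ediam A ^ s + ε := by
    simpa using ENNReal.lt_add_right (ENNReal.rpow_ne_top_of_nonneg hs.le hA) hε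
  have hev : ∀ᶠ δ : NNReal in 𝓝[>] 0,
      (Metric.ediam A + 2 * (δ : ℝ≥0∞)) ^ s < Metric.ediam A ^ s + ε :=
    (hcont.tendsto 0).eventually_lt_const hlt |>.filter_mono nhdsWithin_le_nhds
  obtain ⟨δ, hδ, hδ0⟩ := (hev.and self_mem_nhdsWithin).exists
  refine ⟨Metric.thickening δ A, Metric.isOpen_thickening,
    Metric.self_subset_thickening (by exact_mod_cast hδ0) A, ?_⟩
  exact (ENNReal.rpow_le_rpow (Metric.ediam_thickening_le δ) hs.le).trans hδ.le

theorem openRegular_contentMeasure (hs : 0 < s) : OpenRegular (contentMeasure X s) := by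
  intro A ε hε
  simp only [contentMeasure_apply hs]
  by_cases hA : hausdorffContent s A = ∞
  · exact ⟨univ, isOpen_univ, subset_univ _, by simp [hA]⟩
  have hε2 : ε / 2 ≠ 0 := by simpa using hε
  obtain ⟨U, hU, hsum⟩ := exists_cover_of_hausdorffContent_lt (ENNReal.lt_add_right hA hε2)
  obtain ⟨δ, hδ, hδsum⟩ := ENNReal.exists_pos_sum_of_countable' hε2 ℕ
  choose G hGo hUG hG using fun i => exists_isOpen_superset_ediam_rpow_le hs (U i) (hδ i).ne'
  refine ⟨⋃ i, G i, isOpen_iUnion hGo, hU.trans (iUnion_mono hUG), ?_⟩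
  calc hausdorffContent s (⋃ i, G i) ≤ ∑' i, Metric.ediam (G i) ^ s :=
        hausdorffContent_le_tsum subset_rfl
    _ ≤ ∑' i, (Metric.ediam (U i) ^ s + δ i) := ENNReal.tsum_le_tsum hG
    _ = (∑' i, Metric.ediam (U i) ^ s) + ∑' i, δ i := ENNReal.tsum_add
    _ ≤ (hausdorffContent s A + ε / 2) + ε / 2 := add_le_add hsum.le hδsum.le
    _ = hausdorffContent s A + ε := by rw [add_assoc, ENNReal.add_halves]

theorem contentMeasure_image_coe_le (hs : 0 < s) (F : Set X) (A : Set F) :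
    contentMeasure X s ((↑) '' A) ≤ contentMeasure F s A := by
  simp only [contentMeasure_apply hs]
  refine le_iInf₂ fun U hU => ?_
  calc hausdorffContent s ((↑) '' A) ≤ ∑' i, Metric.ediam (((↑) : F → X) '' U i) ^ s :=
        hausdorffContent_le_tsum ((image_mono hU).trans_eq image_iUnion)
    _ = ∑' i, Metric.ediam (U i) ^ s := by simp only [isometry_subtype_coe.ediam_image]

theorem hausdorffContent_le_hausdorffMeasure [MeasurableSpace X] [BorelSpace X] (hs : 0 < s) :
    hausdorffContent s A ≤ μH[s] A := by
  rw [Measure.hausdorffMeasure_apply]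
  refine le_iSup₂_of_le 1 one_pos (le_iInf₂ fun U hU => le_iInf fun _ => ?_)
  refine (hausdorffContent_le_tsum hU).trans (ENNReal.tsum_le_tsum fun i => ?_)
  rcases (U i).eq_empty_or_nonempty with hi | hi
  · simp [hi, hs]
  · simp [hi]

theorem hausdorffContent_eq_zero_of_dimH_lt (h : dimH A < ENNReal.ofReal s) :
    hausdorffContent s A = 0 := by
  borelize X
  have hs : 0 < s := ENNReal.ofReal_pos.1 (pos_of_gt h)
  refine le_antisymm ((hausdorffContent_le_hausdorffMeasure hs).trans_eq ?_) bot_le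
  simpa only [Real.coe_toNNReal s hs.le] using hausdorffMeasure_of_dimH_lt (d := s.toNNReal) h

theorem hausdorffMeasure_eq_zero_of_hausdorffContent_eq_zero [MeasurableSpace X] [BorelSpace X]
    (hs : 0 < s) (h : hausdorffContent s A = 0) : μH[s] A = 0 := by
  rw [Measure.hausdorffMeasure_apply]
  refine le_antisymm (iSup₂_le fun ρ hρ => le_of_forall_gt_imp_ge_of_dense fun ε hε => ?_) bot_le
  have hρs : 0 < ρ ^ s := by
    rcases eq_or_ne ρ ∞ with rfl | hρt
    · simp [ENNReal.top_rpow_of_pos hs]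
    · exact ENNReal.rpow_pos hρ hρt
  obtain ⟨U, hU, hsum⟩ := exists_cover_of_hausdorffContent_lt (h ▸ lt_min hε hρs)
  obtain ⟨hsum_ε, hsum_ρ⟩ := lt_min_iff.1 hsum
  refine iInf₂_le_of_le U hU (iInf_le_of_le (fun i => ?_) ?_)
  · exact (ENNReal.rpow_le_rpow_iff hs).1 ((ENNReal.le_tsum i).trans hsum_ρ.le)
  · refine le_trans (ENNReal.tsum_le_tsum fun i => ?_) hsum_ε.le
    exact iSup_le fun _ => le_rfl

theorem dimH_le_of_forall_rat_hausdorffContent_eq_zero {t : ℝ≥0∞}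
    (h : ∀ q : ℚ, t < ENNReal.ofReal q → hausdorffContent q A = 0) : dimH A ≤ t := by
  borelize X
  by_contra! hlt
  obtain ⟨q, -, htq, hqA⟩ := ENNReal.lt_iff_exists_rat_btwn.1 hlt
  have hq : (0 : ℝ) < q := ENNReal.ofReal_pos.1 (pos_of_gt htq)
  have htop : μH[q] A = ∞ := by
    simpa only [Real.coe_toNNReal _ hq.le] using hausdorffMeasure_of_lt_dimH hqA
  have hzero := hausdorffMeasure_eq_zero_of_hausdorffContent_eq_zero hq (h q htq)
  exact ENNReal.zero_ne_top (hzero.symm.trans htop)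

theorem hausdorffContent_le_hausdorffContent (hs : 0 < s) (hst : s ≤ t)
    (h : hausdorffContent s A < 1) : hausdorffContent t A ≤ hausdorffContent s A := by
  refine le_of_forall_gt_imp_ge_of_dense fun b hb => ?_
  obtain ⟨U, hU, hsum⟩ := exists_cover_of_hausdorffContent_lt (lt_min hb h)
  obtain ⟨hsum_b, hsum_one⟩ := lt_min_iff.1 hsum
  have hdiam i : Metric.ediam (U i) ≤ 1 := by
    rw [← ENNReal.rpow_le_rpow_iff hs, ENNReal.one_rpow]
    exact (ENNReal.le_tsum i).trans hsum_one.le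
  calc hausdorffContent t A ≤ ∑' i, Metric.ediam (U i) ^ t := hausdorffContent_le_tsum hU
    _ ≤ ∑' i, Metric.ediam (U i) ^ s :=
        ENNReal.tsum_le_tsum fun i => ENNReal.rpow_le_rpow_of_exponent_ge (hdiam i) hst
    _ ≤ b := hsum_b.le

theorem neg_one_lt_coe_ennreal (t : ℝ≥0∞) : (-1 : EReal) < t :=
  (by norm_num : (-1 : EReal) < 0).trans_le (EReal.coe_ennreal_nonneg t)

theorem hausdorffDim_le_coe_iff {t : ℝ≥0∞} : hausdorffDim A ≤ t ↔ dimH A ≤ t := by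
  rw [hausdorffDim]
  split_ifs with hA
  · simp [hA, (neg_one_lt_coe_ennreal t).le]
  · exact EReal.coe_ennreal_le_coe_ennreal_iff

theorem hausdorffDim_lt_coe_iff {t : ℝ≥0∞} (ht : 0 < t) : hausdorffDim A < t ↔ dimH A < t := by
  rw [hausdorffDim]
  split_ifs with hA
  · simp [hA, neg_one_lt_coe_ennreal t, ht]
  · exact EReal.coe_ennreal_lt_coe_ennreal_iff

end Content

section Partitions

/-- Two open sets with disjoint closures. Enlarging such pairs countably often and passing to the
limit is how partitions are constructed. -/
structure OpenPair (X : Type*) [TopologicalSpace X] where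
  left : Set X
  right : Set X
  isOpen_left : IsOpen left
  isOpen_right : IsOpen right
  disjoint_closure : Disjoint (closure left) (closure right)

variable {X : Type*} [TopologicalSpace X] {A A' B B' C L S T : Set X}

namespace OpenPair

instance : Preorder (OpenPair X) := Preorder.lift fun p => (p.left, p.right)

/-- The closed set left over by an `OpenPair`. -/
def gap (p : OpenPair X) : Set X := (p.left ∪ p.right)ᶜ

theorem disjoint (p : OpenPair X) : Disjoint p.left p.right :=
  p.disjoint_closure.mono subset_closure subset_closure

end OpenPair

theorem exists_openPair [NormalSpace X] (hS : IsClosed S) (hT : IsClosed T) (hST : Disjoint S T) :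
    ∃ p : OpenPair X, S ⊆ p.left ∧ T ⊆ p.right := by
  obtain ⟨P, hP, hSP, hPT⟩ :=
    normal_exists_closure_subset hS hT.isOpen_compl hST.subset_compl_right
  obtain ⟨Q, hQ, hTQ, hQP⟩ :=
    normal_exists_closure_subset hT isClosed_closure.isOpen_compl (subset_compl_comm.1 hPT)
  exact ⟨⟨P, Q, hP, hQ, (disjoint_compl_left.mono_left hQP).symm⟩, hSP, hTQ⟩

theorem exists_isPartitionBetween [NormalSpace X] (hA : IsClosed A) (hB : IsClosed B)
    (hAB : Disjoint A B) : ∃ L, IsPartitionBetween A B L := by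
  obtain ⟨U, V, hU, hV, hAU, hBV, hUV⟩ := normal_separation hA hB hAB
  exact ⟨_, U, V, hU, hV, hAU, hBV, hUV.inter_eq, rfl⟩

theorem exists_isPartitionBetween_of_separated [CompletelyNormalSpace X]
    (h₁ : Disjoint (closure A) B) (h₂ : Disjoint A (closure B)) :
    ∃ L, IsPartitionBetween A B L := by
  obtain ⟨U, V, hU, hV, hAU, hBV, hUV⟩ := separatedNhds_iff_disjoint.2 (completely_normal h₁ h₂)
  exact ⟨_, U, V, hU, hV, hAU, hBV, hUV.inter_eq, rfl⟩

namespace IsPartitionBetween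

theorem mono (h : IsPartitionBetween A B L) (hA : A' ⊆ A) (hB : B' ⊆ B) :
    IsPartitionBetween A' B' L := by
  obtain ⟨U, V, hU, hV, hAU, hBV, h⟩ := h
  exact ⟨U, V, hU, hV, hA.trans hAU, hB.trans hBV, h⟩

theorem subset_compl_union (h : IsPartitionBetween A B L) : L ⊆ (A ∪ B)ᶜ := by
  obtain ⟨U, V, -, -, hAU, hBV, -, rfl⟩ := h
  exact compl_subset_compl.2 (union_subset_union hAU hBV)

theorem isClosed (h : IsPartitionBetween A B L) : IsClosed L := by
  obtain ⟨U, V, hU, hV, -, -, -, rfl⟩ := h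
  exact (hU.union hV).isClosed_compl

theorem exists_openPair_ge [NormalSpace X] {p : OpenPair X}
    (hL : IsPartitionBetween (closure p.left) (closure p.right) L) (hC : IsClosed C)
    (hCL : Disjoint C L) : ∃ q, p ≤ q ∧ C ⊆ q.left ∪ q.right := by
  obtain ⟨U, V, hU, hV, hpU, hpV, hUV, rfl⟩ := hL
  rw [disjoint_compl_right_iff_subset] at hCL
  have hdisj : Disjoint (closure p.left ∪ C \ V) (closure p.right ∪ C \ U) := by
    have hUV' : Disjoint (C \ V) (C \ U) :=
      disjoint_left.2 fun x hx hx' => (hCL hx.1).elim hx'.2 hx.2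
    rw [disjoint_union_left, disjoint_union_right, disjoint_union_right]
    exact ⟨⟨p.disjoint_closure, disjoint_sdiff_right.mono_left hpU⟩,
      disjoint_sdiff_left.mono_right hpV, hUV'⟩
  obtain ⟨q, hleft, hright⟩ := exists_openPair (isClosed_closure.union (hC.sdiff hV))
    (isClosed_closure.union (hC.sdiff hU)) hdisj
  refine ⟨q, ⟨subset_closure.trans (subset_union_left.trans hleft),
    subset_closure.trans (subset_union_left.trans hright)⟩, fun x hx => ?_⟩
  by_cases hxV : x ∈ V
  · have hxU : x ∉ U := fun hxU => (hUV.subset ⟨hxU, hxV⟩).elim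
    exact .inr (hright (.inr ⟨hx, hxU⟩))
  · exact .inl (hleft (.inr ⟨hx, hxV⟩))

end IsPartitionBetween

theorem OpenPair.exists_isPartitionBetween_of_monotone {ι : Type*} [Preorder ι] [IsDirectedOrder ι]
    {p : ι → OpenPair X} (hp : Monotone p) :
    ∃ L, ∀ m, IsPartitionBetween (p m).left (p m).right L := by
  have hdisj : Disjoint (⋃ m, (p m).left) (⋃ m, (p m).right) := by
    simp only [disjoint_iUnion_left, disjoint_iUnion_right]
    intro m k
    obtain ⟨l, hml, hkl⟩ := exists_ge_ge m k
    exact (p l).disjoint.mono (hp hkl).1 (hp hml).2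
  exact ⟨_, fun m => ⟨_, _, isOpen_iUnion fun k => (p k).isOpen_left,
    isOpen_iUnion fun k => (p k).isOpen_right, subset_iUnion (fun k => (p k).left) m,
    subset_iUnion (fun k => (p k).right) m, hdisj.inter_eq, rfl⟩⟩

theorem disjoint_closure_union_image_coe {F P Q : Set X} {U V : Set F}
    (hPQ : Disjoint (closure P) Q) (hQ : IsOpen Q) (hV : IsOpen V) (hUV : Disjoint U V)
    (hPU : (↑) ⁻¹' closure P ⊆ U) (hQV : (↑) ⁻¹' Q ⊆ V) :
    Disjoint (closure (P ∪ (↑) '' U)) (Q ∪ (↑) '' V) := by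
  rw [closure_union, disjoint_union_left, disjoint_union_right, disjoint_union_right]
  refine ⟨⟨hPQ, ?_⟩, Disjoint.closure_left ?_ hQ, ?_⟩
  · exact disjoint_image_right.2 (hUV.mono_left hPU)
  · exact disjoint_image_left.2 (hUV.mono_right hQV)
  · rw [disjoint_image_right, ← IsInducing.subtypeVal.closure_eq_preimage_closure_image]
    exact hUV.closure_left hV

theorem IsPartitionBetween.exists_preimage_coe_subset [CompletelyNormalSpace X] {F : Set X}
    {p : OpenPair X} {L : Set F}
    (hL : IsPartitionBetween ((↑) ⁻¹' closure p.left) ((↑) ⁻¹' closure p.right) L) :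
    ∃ L', IsPartitionBetween p.left p.right L' ∧ (↑) ⁻¹' L' ⊆ L := by
  obtain ⟨U, V, hU, hV, hpU, hpV, hUV, rfl⟩ := hL
  have hUV : Disjoint U V := disjoint_iff_inter_eq_empty.2 hUV
  obtain ⟨L', hL'⟩ := exists_isPartitionBetween_of_separated
    (disjoint_closure_union_image_coe (p.disjoint_closure.mono_right subset_closure)
      p.isOpen_right hV hUV hpU ((preimage_mono subset_closure).trans hpV))
    (disjoint_closure_union_image_coe (p.disjoint_closure.symm.mono_right subset_closure)
      p.isOpen_left hU hUV.symm hpV ((preimage_mono subset_closure).trans hpU)).symm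
  refine ⟨L', hL'.mono subset_union_left subset_union_left, fun x hx hxUV => ?_⟩
  exact hL'.subset_compl_union hx
    (hxUV.imp (fun h => .inr (mem_image_of_mem _ h)) fun h => .inr (mem_image_of_mem _ h))

end Partitions

section AlmostPartitionable

variable {X : Type*} [TopologicalSpace X] {n : ℕ} {μ ν : OuterMeasure X} {F : Set X}

/-- Any `n` pairs of disjoint closed sets have partitions whose intersection has arbitrarily
small measure inside `F`. For `μ = ⊤` the intersection misses `F`, so that this interpolates
between the partition characterization of `dim F < n` and smallness of the content. -/
def AlmostPartitionable (n : ℕ) (μ : OuterMeasure X) (F : Set X) : Prop :=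
  ∀ ε : ℝ≥0∞, ε ≠ 0 → ∀ A B : Fin n → Set X,
    (∀ i, IsClosed (A i)) → (∀ i, IsClosed (B i)) → (∀ i, Disjoint (A i) (B i)) →
    ∃ L : Fin n → Set X, (∀ i, IsPartitionBetween (A i) (B i) (L i)) ∧ μ (F ∩ ⋂ i, L i) ≤ ε

namespace AlmostPartitionable

theorem of_isEmpty [IsEmpty X] (n : ℕ) (μ : OuterMeasure X) (F : Set X) :
    AlmostPartitionable n μ F := by
  intro ε _ A B hA hB hAB
  choose L hL using fun i => exists_isPartitionBetween (hA i) (hB i) (hAB i)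
  exact ⟨L, hL, by simp [Set.eq_empty_of_isEmpty]⟩

theorem mono (h : AlmostPartitionable n ν F) (hμν : μ ≤ ν) : AlmostPartitionable n μ F :=
  fun ε hε A B hA hB hAB =>
    let ⟨L, hL, hνL⟩ := h ε hε A B hA hB hAB
    ⟨L, hL, (hμν _).trans hνL⟩

theorem of_subtype [CompletelyNormalSpace X]
    (h : AlmostPartitionable n (OuterMeasure.comap ((↑) : F → X) μ) univ) :
    AlmostPartitionable n μ F := by
  intro ε hε A B hA hB hAB
  choose p hAp hBp using fun i => exists_openPair (hA i) (hB i) (hAB i)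
  obtain ⟨L, hL, hμL⟩ := h ε hε (fun i => (↑) ⁻¹' closure (p i).left)
    (fun i => (↑) ⁻¹' closure (p i).right)
    (fun i => isClosed_closure.preimage continuous_subtype_val)
    (fun i => isClosed_closure.preimage continuous_subtype_val)
    (fun i => (p i).disjoint_closure.preimage _)
  choose L' hL' hL'L using fun i => (hL i).exists_preimage_coe_subset
  refine ⟨L', fun i => (hL' i).mono (hAp i) (hBp i), (measure_mono ?_).trans hμL⟩
  rintro x ⟨hxF, hx⟩
  exact ⟨⟨x, hxF⟩, ⟨mem_univ _, mem_iInter.2 fun i => hL'L i (mem_iInter.1 hx i)⟩, rfl⟩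

theorem exists_ge_measure_gap_le [NormalSpace X] (h : AlmostPartitionable n μ F)
    (hμ : OpenRegular μ) (hF : IsClosed F) {J : Type*} {g : Fin n → J}
    (hg : Function.Injective g) (p : J → OpenPair X) {ε : ℝ≥0∞} (hε : ε ≠ 0) :
    ∃ q, p ≤ q ∧ μ (F ∩ ⋂ i, (q (g i)).gap) ≤ ε := by
  have hε2 : ε / 2 ≠ 0 := by simpa using hε
  obtain ⟨L, hL, hμL⟩ := h (ε / 2) hε2 (fun i => closure (p (g i)).left)
    (fun i => closure (p (g i)).right) (fun i => isClosed_closure) (fun i => isClosed_closure)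
    (fun i => (p (g i)).disjoint_closure)
  obtain ⟨G, hG, hLG, hμG⟩ := hμ (F ∩ ⋂ i, L i) (ε / 2) hε2
  have hcov : F \ G ⊆ ⋃ i, (L i)ᶜ := fun x hx => by
    rw [← compl_iInter]
    exact fun hxL => hx.2 (hLG ⟨hx.1, hxL⟩)
  obtain ⟨C, hcovC, hC, hCL⟩ := exists_subset_iUnion_closed_subset (hF.sdiff hG)
    (fun i => (hL i).isClosed.isOpen_compl) (fun _ _ => toFinite _) hcov
  choose q hpq hCq using fun i =>
    (hL i).exists_openPair_ge (hC i) (disjoint_compl_left.mono_left (hCL i))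
  refine ⟨Function.extend g q p, fun j => ?_, ?_⟩
  · by_cases hj : ∃ i, g i = j
    · obtain ⟨i, rfl⟩ := hj
      exact (hpq i).trans_eq (hg.extend_apply q p i).symm
    · exact (Function.extend_apply' q p j hj).ge
  · simp only [hg.extend_apply]
    have hgap : F ∩ ⋂ i, (q i).gap ⊆ G := fun x hx => by
      by_contra hxG
      obtain ⟨i, hi⟩ := mem_iUnion.1 (hcovC ⟨hx.1, hxG⟩)
      exact mem_iInter.1 hx.2 i (hCq i hi)
    calc μ (F ∩ ⋂ i, (q i).gap) ≤ μ G := measure_mono hgap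
      _ ≤ ε / 2 + ε / 2 := hμG.trans (by gcongr)
      _ = ε := ENNReal.add_halves ε

end AlmostPartitionable

theorem exists_isPartitionBetween_forall_measure_le [NormalSpace X] {J T : Type*} [Countable T]
    {μ : T → OuterMeasure X} {F : T → Set X} {ε : T → ℝ≥0∞} {g : T → Fin n → J}
    (h : ∀ t, AlmostPartitionable n (μ t) (F t)) (hμ : ∀ t, OpenRegular (μ t))
    (hF : ∀ t, IsClosed (F t)) (hε : ∀ t, ε t ≠ 0) (hg : ∀ t, Function.Injective (g t))
    (p : J → OpenPair X) :
    ∃ L : J → Set X, (∀ j, IsPartitionBetween (p j).left (p j).right (L j)) ∧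
      ∀ t, μ t (F t ∩ ⋂ i, L (g t i)) ≤ ε t := by
  have := Encodable.ofCountable T
  let 𝒟 t : Order.Cofinal (J → OpenPair X) :=
    ⟨{q | μ t (F t ∩ ⋂ i, (q (g t i)).gap) ≤ ε t}, fun q =>
      let ⟨q', hqq', hq'⟩ := (h t).exists_ge_measure_gap_le (hμ t) (hF t) (hg t) q (hε t)
      ⟨q', hq', hqq'⟩⟩
  have hmono : Monotone (Order.sequenceOfCofinals p 𝒟) := Order.sequenceOfCofinals.monotone p 𝒟
  choose L hL using fun j => OpenPair.exists_isPartitionBetween_of_monotone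
    (p := fun m => Order.sequenceOfCofinals p 𝒟 m j) fun _ _ hmk => hmono hmk j
  refine ⟨L, fun j => hL j 0, fun t => (measure_mono ?_).trans
    (Order.sequenceOfCofinals.encode_mem p 𝒟 t)⟩
  exact inter_subset_inter_right _ (iInter_mono fun i => (hL _ _).subset_compl_union)

theorem AlmostPartitionable.iUnion [NormalSpace X] {T : Type*} [Countable T] {F : T → Set X}
    (h : ∀ t, AlmostPartitionable n μ (F t)) (hμ : OpenRegular μ) (hF : ∀ t, IsClosed (F t)) :
    AlmostPartitionable n μ (⋃ t, F t) := by
  intro ε hε A B hA hB hAB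
  choose p hAp hBp using fun i => exists_openPair (hA i) (hB i) (hAB i)
  obtain ⟨δ, hδ, hδε⟩ := ENNReal.exists_pos_sum_of_countable' hε T
  obtain ⟨L, hL, hμL⟩ := exists_isPartitionBetween_forall_measure_le h (fun _ => hμ) hF
    (fun t => (hδ t).ne') (fun _ => Function.injective_id) p
  refine ⟨L, fun i => (hL i).mono (hAp i) (hBp i), ?_⟩
  calc μ ((⋃ t, F t) ∩ ⋂ i, L i) = μ (⋃ t, F t ∩ ⋂ i, L i) := by rw [iUnion_inter]
    _ ≤ ∑' t, μ (F t ∩ ⋂ i, L i) := measure_iUnion_le _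
    _ ≤ ∑' t, δ t := ENNReal.tsum_le_tsum hμL
    _ ≤ ε := hδε.le

/-- The open set of points that lie in a member of `V` of colour `i`, but outside the closures of
the earlier members of the other colours. -/
def colorPart {ι : Type*} (V : ℕ → Set X) (c : ℕ → ι) (i : ι) : Set X :=
  ⋃ k ∈ c ⁻¹' {i}, V k \ ⋃ j ∈ {j | j < k ∧ c j ≠ i}, closure (V j)

section colorPart

variable {ι : Type*} {V : ℕ → Set X} {c : ℕ → ι} {i j : ι} {x : X}

theorem mem_colorPart : x ∈ colorPart V c i ↔
    ∃ k, c k = i ∧ x ∈ V k ∧ ∀ j < k, c j ≠ i → x ∉ closure (V j) := by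
  simp [colorPart, and_left_comm]

theorem isOpen_colorPart (hV : ∀ k, IsOpen (V k)) (c : ℕ → ι) (i : ι) :
    IsOpen (colorPart V c i) :=
  isOpen_biUnion fun k _ => (hV k).sdiff <|
    ((finite_lt_nat k).subset fun _ hj => hj.1).isClosed_biUnion fun _ _ => isClosed_closure

theorem disjoint_colorPart (V : ℕ → Set X) (c : ℕ → ι) (hij : i ≠ j) :
    Disjoint (colorPart V c i) (colorPart V c j) := by
  refine disjoint_left.2 fun x hxi hxj => ?_
  obtain ⟨k, rfl, hxk, hk⟩ := mem_colorPart.1 hxi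
  obtain ⟨l, rfl, hxl, hl⟩ := mem_colorPart.1 hxj
  rcases lt_trichotomy k l with h | rfl | h
  · exact hl k h hij (subset_closure hxk)
  · exact hij rfl
  · exact hk l h hij.symm (subset_closure hxl)

theorem mem_colorPart_of_forall (hcov : ⋃ k, V k = univ) (h : ∀ k, x ∈ closure (V k) → c k = i) :
    x ∈ colorPart V c i := by
  obtain ⟨k, hk⟩ := mem_iUnion.1 (hcov ▸ mem_univ x)
  exact mem_colorPart.2 ⟨k, h k (subset_closure hk), hk, fun j _ hji hxj => hji (h j hxj)⟩

theorem mem_colorPart_or_mem_frontier (c : ℕ → ι) (hcov : ⋃ k, V k = univ) (x : X) :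
    (∃ i, x ∈ colorPart V c i) ∨ ∃ k, x ∈ frontier (V k) := by
  classical
  have hex : ∃ k, x ∈ closure (V k) :=
    (mem_iUnion.1 (hcov ▸ mem_univ x)).imp fun _ hk => subset_closure hk
  by_cases hx : x ∈ V (Nat.find hex)
  · exact .inl ⟨_, mem_colorPart.2 ⟨Nat.find hex, rfl, hx, fun j hj _ => Nat.find_min hex hj⟩⟩
  · exact .inr ⟨Nat.find hex, Nat.find_spec hex, fun h => hx (interior_subset h)⟩

end colorPart

theorem exists_seq_cover [LindelofSpace X] [Nonempty X] {P : Set X → Prop}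
    (hP : ∀ x, ∃ V ∈ 𝓝 x, P V) : ∃ V : ℕ → Set X, (∀ k, P (V k)) ∧ ⋃ k, V k = univ := by
  choose V hV hPV using hP
  obtain ⟨s, hs, hcov⟩ := LindelofSpace.elim_nhds_subcover V hV
  have hne : s.Nonempty := by
    by_contra! h
    simp only [h, mem_empty_iff_false, iUnion_of_empty, iUnion_empty] at hcov
    exact empty_ne_univ hcov
  obtain ⟨e, rfl⟩ := hs.exists_eq_range hne
  exact ⟨fun k => V (e k), fun k => hPV _, by simpa using hcov⟩

theorem exists_isPartitionBetween_subset_iUnion_frontier [RegularSpace X] [LindelofSpace X]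
    [Nonempty X] {𝓤 : Set (Set X)} (h𝓤 : IsTopologicalBasis 𝓤) {A B : Set X} (hA : IsClosed A)
    (hB : IsClosed B) (hAB : Disjoint A B) :
    ∃ (L : Set X) (V : ℕ → Set X), IsPartitionBetween A B L ∧ (∀ k, V k ∈ 𝓤) ∧
      L ⊆ ⋃ k, frontier (V k) := by
  have hloc : ∀ x, ∃ V ∈ 𝓝 x, V ∈ 𝓤 ∧ ∃ b : Bool, Disjoint (closure V) (bif b then B else A) := by
    intro x
    obtain ⟨b, hb⟩ : ∃ b : Bool, x ∉ bif b then B else A := by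
      by_cases hx : x ∈ B
      · exact ⟨false, hAB.notMem_of_mem_right hx⟩
      · exact ⟨true, hx⟩
    have hopen : IsOpen (bif b then B else A)ᶜ := by cases b <;> simpa [isOpen_compl_iff]
    obtain ⟨V, hV, hxV, hVC⟩ := h𝓤.exists_closure_subset (hopen.mem_nhds hb)
    exact ⟨V, h𝓤.mem_nhds hV hxV, hV, b, disjoint_left.2 hVC⟩
  obtain ⟨V, hV, hcov⟩ := exists_seq_cover hloc
  choose hV𝓤 c hc using hV
  have hVo k : IsOpen (V k) := h𝓤.isOpen (hV𝓤 k)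
  refine ⟨_, V, ⟨colorPart V c true, colorPart V c false, isOpen_colorPart hVo c _,
    isOpen_colorPart hVo c _, fun x hx => mem_colorPart_of_forall hcov fun k hk => ?_,
    fun x hx => mem_colorPart_of_forall hcov fun k hk => ?_,
    (disjoint_colorPart V c (by decide)).inter_eq, rfl⟩, hV𝓤, fun x hx => ?_⟩
  · by_contra h
    exact disjoint_left.1 (hc k) hk (by simpa [h] using hx)
  · by_contra h
    exact disjoint_left.1 (hc k) hk (by simpa [h] using hx)
  · refine mem_iUnion.2 ((mem_colorPart_or_mem_frontier c hcov x).resolve_left ?_)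
    rintro ⟨_ | _, h⟩
    exacts [hx (.inr h), hx (.inl h)]

theorem AlmostPartitionable.succ_of_isTopologicalBasis [RegularSpace X] [LindelofSpace X]
    {𝓤 : Set (Set X)} (h𝓤 : IsTopologicalBasis 𝓤)
    (h : ∀ U ∈ 𝓤, AlmostPartitionable n μ (frontier U)) (hμ : OpenRegular μ) :
    AlmostPartitionable (n + 1) μ univ := by
  rcases isEmpty_or_nonempty X with hX | hX
  · exact .of_isEmpty _ _ _
  intro ε hε A B hA hB hAB
  obtain ⟨L₀, V, hL₀, hV, hLV⟩ :=
    exists_isPartitionBetween_subset_iUnion_frontier h𝓤 (hA 0) (hB 0) (hAB 0)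
  obtain ⟨L, hL, hμL⟩ := AlmostPartitionable.iUnion (fun k => h _ (hV k)) hμ
    (fun k => isClosed_frontier) ε hε (Fin.tail A) (Fin.tail B) (fun _ => hA _) (fun _ => hB _)
    (fun _ => hAB _)
  refine ⟨Fin.cons L₀ L, Fin.cases hL₀ hL, (measure_mono ?_).trans hμL⟩
  rintro x ⟨-, hx⟩
  exact ⟨hLV (mem_iInter.1 hx 0), mem_iInter.2 fun i => mem_iInter.1 hx i.succ⟩

theorem almostPartitionable_top_of_hasSmallInductiveDimensionLT [RegularSpace X]
    [SecondCountableTopology X] (h : HasSmallInductiveDimensionLT X n) :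
    AlmostPartitionable n (⊤ : OuterMeasure X) univ := by
  induction n generalizing X with
  | zero =>
    have := hasSmallInductiveDimensionLT_zero_iff.1 h
    exact .of_isEmpty _ _ _
  | succ n ih =>
    cases h with | succ _ 𝓤 h𝓤 h =>
    exact .succ_of_isTopologicalBasis h𝓤 (fun U hU => .of_subtype ((ih (h U hU)).mono le_top))
      openRegular_top

theorem almostPartitionable_contentMeasure_of_indTopHausdorffDim_lt {X : Type*} [MetricSpace X]
    [SecondCountableTopology X] {s : ℝ} (hs : 0 < s)
    (h : indTopHausdorffDim n X < n + (ENNReal.ofReal s : EReal)) :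
    AlmostPartitionable n (contentMeasure X s) univ := by
  induction n generalizing X with
  | zero =>
    intro ε _ A B _ _ _
    rw [indTopHausdorffDim, Nat.cast_zero, zero_add,
      hausdorffDim_lt_coe_iff (ENNReal.ofReal_pos.2 hs)] at h
    refine ⟨Fin.elim0, Fin.rec0, le_of_eq_of_le ?_ bot_le⟩
    rw [contentMeasure_apply hs]
    exact hausdorffContent_eq_zero_of_dimH_lt ((dimH_mono (subset_univ _)).trans_lt h)
  | succ n ih =>
    rw [indTopHausdorffDim] at h
    split_ifs at h with hX
    · exact .of_isEmpty _ _ _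
    obtain ⟨d, ⟨𝓤, h𝓤, hd⟩, hdlt⟩ := sInf_lt_iff.1 h
    have hlt : d - 1 < n + (ENNReal.ofReal s : EReal) := EReal.sub_lt_of_lt_add (by
      rwa [Nat.cast_succ, add_right_comm] at hdlt)
    refine .succ_of_isTopologicalBasis h𝓤 (fun U hU =>
      .of_subtype ((ih ((hd U hU).trans_lt hlt)).mono fun A => ?_)) (openRegular_contentMeasure hs)
    exact contentMeasure_image_coe_le hs (frontier U) A

end AlmostPartitionable

section Decomposition

variable {X Y : Type*} [TopologicalSpace X] [TopologicalSpace Y] {n : ℕ} {S Z : Set X}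

/-- `Z` has dimension at most `0` relative to `X`: the open sets whose frontiers miss `Z` form a
basis of the whole space. In metric spaces this is equivalent to `dim Z ≤ 0`. -/
def IsZeroDimIn (Z : Set X) : Prop :=
  IsTopologicalBasis {V : Set X | IsOpen V ∧ Disjoint (frontier V) Z}

theorem IsZeroDimIn.preimage {f : Y → X} (h : IsZeroDimIn Z) (hf : IsInducing f) :
    IsZeroDimIn (f ⁻¹' Z) := by
  refine (h.isInducing hf).of_isOpen_of_subset (fun V hV => hV.1) ?_
  rintro _ ⟨V, ⟨hV, hVZ⟩, rfl⟩
  exact ⟨hV.preimage hf.continuous,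
    (hVZ.preimage f).mono_left (hf.continuous.frontier_preimage_subset V)⟩

/-- `S` is covered by `n` zero-dimensional sets. In separable metric spaces this is equivalent to
`dim S < n`. -/
def IsZeroDimUnion (n : ℕ) (S : Set X) : Prop :=
  ∃ Z : Fin n → Set X, (∀ i, IsZeroDimIn (Z i)) ∧ S ⊆ ⋃ i, Z i

theorem IsZeroDimUnion.exists_isTopologicalBasis (h : IsZeroDimUnion (n + 1) S) :
    ∃ 𝓤 : Set (Set X), IsTopologicalBasis 𝓤 ∧
      ∀ U ∈ 𝓤, IsZeroDimUnion n ((↑) ⁻¹' S : Set (frontier U)) := by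
  obtain ⟨Z, hZ, hSZ⟩ := h
  refine ⟨_, hZ 0, fun U hU => ⟨fun i => (↑) ⁻¹' Z i.succ,
    fun i => (hZ i.succ).preimage .subtypeVal, fun x hx => ?_⟩⟩
  obtain ⟨i, hi⟩ := mem_iUnion.1 (hSZ hx)
  cases i using Fin.cases with
  | zero => exact (disjoint_left.1 hU.2 x.2 hi).elim
  | succ i => exact mem_iUnion.2 ⟨i, hi⟩

theorem hasSmallInductiveDimensionLT_of_isZeroDimUnion_univ
    (h : IsZeroDimUnion n (univ : Set X)) : HasSmallInductiveDimensionLT X n := by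
  induction n generalizing X with
  | zero =>
    obtain ⟨Z, -, hZ⟩ := h
    rw [hasSmallInductiveDimensionLT_zero_iff, ← univ_eq_empty_iff]
    simpa using hZ
  | succ n ih =>
    obtain ⟨𝓤, h𝓤, h⟩ := h.exists_isTopologicalBasis
    exact .succ n 𝓤 h𝓤 fun U hU => ih (h U hU)

theorem IsZeroDimUnion.hasSmallInductiveDimensionLT (h : IsZeroDimUnion n S) :
    HasSmallInductiveDimensionLT S n := by
  obtain ⟨Z, hZ, hSZ⟩ := h
  refine hasSmallInductiveDimensionLT_of_isZeroDimUnion_univ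
    ⟨fun i => (↑) ⁻¹' Z i, fun i => (hZ i).preimage .subtypeVal, fun x _ => ?_⟩
  simpa using hSZ x.2

/-- `X` is the union of a set of Hausdorff dimension at most `t` and `n` zero-dimensional sets. -/
def HasDimDecomposition (n : ℕ) (t : ℝ≥0∞) (X : Type*) [MetricSpace X] : Prop :=
  ∃ A : Set X, dimH A ≤ t ∧ IsZeroDimUnion n Aᶜ

theorem HasDimDecomposition.exists_isTopologicalBasis {X : Type*} [MetricSpace X] {t : ℝ≥0∞}
    (h : HasDimDecomposition (n + 1) t X) : ∃ 𝓤 : Set (Set X), IsTopologicalBasis 𝓤 ∧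
      ∀ U ∈ 𝓤, HasDimDecomposition n t (frontier U) := by
  obtain ⟨A, hA, h⟩ := h
  obtain ⟨𝓤, h𝓤, h⟩ := h.exists_isTopologicalBasis
  refine ⟨𝓤, h𝓤, fun U hU => ⟨(↑) ⁻¹' A, ?_, by exact h U hU⟩⟩
  rw [← isometry_subtype_coe.dimH_image]
  exact (dimH_mono (image_preimage_subset _ _)).trans hA

theorem HasDimDecomposition.indTopHausdorffDim_le {X : Type*} [MetricSpace X] {t : ℝ≥0∞}
    (h : HasDimDecomposition n t X) : indTopHausdorffDim n X ≤ n + (t : EReal) := by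
  induction n generalizing X with
  | zero =>
    obtain ⟨A, hA, Z, -, hZ⟩ := h
    rw [iUnion_of_empty, subset_empty_iff, compl_empty_iff] at hZ
    rwa [indTopHausdorffDim, Nat.cast_zero, zero_add, hausdorffDim_le_coe_iff, ← hZ]
  | succ n ih =>
    rw [indTopHausdorffDim]
    split_ifs with hX
    · exact (neg_one_lt_coe_ennreal ((n + 1 : ℕ) + t)).le.trans_eq (EReal.coe_ennreal_add _ _)
    · obtain ⟨𝓤, h𝓤, h⟩ := h.exists_isTopologicalBasis
      refine sInf_le ⟨𝓤, h𝓤, fun U hU => (ih (h U hU)).trans_eq ?_⟩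
      rw [Nat.cast_succ, add_right_comm]
      exact (EReal.add_sub_cancel_right (b := (1 : ℝ))).symm

theorem exists_countable_openPair_forall_nhds [RegularSpace X] [SecondCountableTopology X] :
    ∃ K : Set (OpenPair X), K.Countable ∧
      ∀ x, ∀ U ∈ 𝓝 x, ∃ p ∈ K, x ∈ p.left ∧ p.rightᶜ ⊆ U := by
  have hB := isBasis_countableBasis X
  let I := {p : countableBasis X × countableBasis X // closure (p.1 : Set X) ⊆ p.2}
  have hdisj (i : I) : Disjoint (closure (i.1.1 : Set X)) (closure (closure (i.1.2 : Set X))ᶜ) := by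
    rw [closure_compl, disjoint_compl_right_iff_subset]
    exact i.2.trans (interior_maximal subset_closure (hB.isOpen i.1.2.2))
  let p (i : I) : OpenPair X := ⟨i.1.1, (closure (i.1.2 : Set X))ᶜ, hB.isOpen i.1.1.2,
    isClosed_closure.isOpen_compl, hdisj i⟩
  refine ⟨range p, countable_range p, fun x U hU => ?_⟩
  obtain ⟨W, hW, hxW, hWU⟩ := hB.exists_closure_subset hU
  obtain ⟨V, hV, hxV, hVW⟩ := hB.exists_closure_subset (hB.mem_nhds hW hxW)
  exact ⟨_, mem_range_self ⟨(⟨V, hV⟩, ⟨W, hW⟩), hVW⟩, hxV, by simpa [p] using hWU⟩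

theorem IsPartitionBetween.exists_isOpen_frontier_subset {A B L : Set X}
    (h : IsPartitionBetween A B L) : ∃ U, IsOpen U ∧ A ⊆ U ∧ U ⊆ Bᶜ ∧ frontier U ⊆ L := by
  obtain ⟨U, V, hU, hV, hAU, hBV, hUV, rfl⟩ := h
  have hUV : Disjoint U V := disjoint_iff_inter_eq_empty.2 hUV
  refine ⟨U, hU, hAU, (hUV.mono_right hBV).subset_compl_right, fun x hx => ?_⟩
  rw [hU.frontier_eq] at hx
  exact not_or.2 ⟨hx.2, disjoint_left.1 (hUV.closure_left hV) hx.1⟩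

theorem isZeroDimIn_compl_iUnion {K : Set (OpenPair X)}
    (hK : ∀ x, ∀ U ∈ 𝓝 x, ∃ p ∈ K, x ∈ p.left ∧ p.rightᶜ ⊆ U) {L : K → Set X}
    (hL : ∀ p : K, IsPartitionBetween p.1.left p.1.right (L p)) :
    IsZeroDimIn (⋃ p, L p)ᶜ := by
  refine isTopologicalBasis_of_isOpen_of_nhds (fun V hV => hV.1) fun x U hx hU => ?_
  obtain ⟨p, hp, hxp, hpU⟩ := hK x U (hU.mem_nhds hx)
  obtain ⟨V, hV, hpV, hVp, hVL⟩ := (hL ⟨p, hp⟩).exists_isOpen_frontier_subset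
  refine ⟨V, ⟨hV, disjoint_compl_right.mono_left ?_⟩, hpV hxp, hVp.trans hpU⟩
  exact hVL.trans (subset_iUnion L ⟨p, hp⟩)

theorem exists_null_isZeroDimUnion_compl [RegularSpace X] [SecondCountableTopology X]
    {ι : Type*} [Countable ι] {μ : ι → OuterMeasure X}
    (h : ∀ k, AlmostPartitionable n (μ k) univ) (hμ : ∀ k, OpenRegular (μ k)) :
    ∃ A, (∀ k, μ k A = 0) ∧ IsZeroDimUnion n Aᶜ := by
  obtain ⟨K, hKc, hK⟩ := exists_countable_openPair_forall_nhds (X := X)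
  have := hKc.to_subtype
  obtain ⟨L, hL, hμL⟩ := exists_isPartitionBetween_forall_measure_le
    (T := ι × (Fin n → K) × ℕ) (ε := fun t => (t.2.2 : ℝ≥0∞)⁻¹) (g := fun t i => (i, t.2.1 i))
    (fun t => h t.1) (fun t => hμ t.1) (fun _ => isClosed_univ) (fun t => by simp)
    (fun t i j hij => congrArg Prod.fst hij) fun j : Fin n × K => j.2.1
  refine ⟨⋃ f : Fin n → K, ⋂ i, L (i, f i), fun k => measure_iUnion_null fun f => ?_,
    fun i => (⋃ p, L (i, p))ᶜ, fun i => isZeroDimIn_compl_iUnion hK fun p => hL (i, p), ?_⟩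
  · by_contra hne
    obtain ⟨m, hm⟩ := ENNReal.exists_inv_nat_lt hne
    exact hm.not_ge (by simpa using hμL (k, f, m))
  · rw [← compl_iInter, compl_subset_compl]
    intro x hx
    choose f hf using fun i => mem_iUnion.1 (mem_iInter.1 hx i)
    exact mem_iUnion.2 ⟨f, mem_iInter.2 hf⟩

theorem HasDimDecomposition.of_almostPartitionable {X : Type*} [MetricSpace X]
    [SecondCountableTopology X] {t : ℝ≥0∞}
    (h : ∀ s : ℝ, t < ENNReal.ofReal s → AlmostPartitionable n (contentMeasure X s) univ) :
    HasDimDecomposition n t X := by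
  have hpos (q : {q : ℚ // t < ENNReal.ofReal q}) : 0 < (q : ℝ) :=
    ENNReal.ofReal_pos.1 (bot_le.trans_lt q.2)
  obtain ⟨A, hA, hAn⟩ := exists_null_isZeroDimUnion_compl
    (μ := fun q : {q : ℚ // t < ENNReal.ofReal q} => contentMeasure X q) (fun q => h q q.2)
    fun q => openRegular_contentMeasure (hpos q)
  refine ⟨A, dimH_le_of_forall_rat_hausdorffContent_eq_zero fun q hq => ?_, hAn⟩
  rw [← contentMeasure_apply (hpos ⟨q, hq⟩)]
  exact hA ⟨q, hq⟩

end Decomposition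

section Covers

variable {ι κ : Type*}

theorem IsZeroDimIn.exists_disjoint_refinement {X : Type*} [TopologicalSpace X] [LindelofSpace X]
    {Z : Set X} (hZ : IsZeroDimIn Z) {𝓤 : ι → Set X} (h𝓤 : IsOpenCoverFamily 𝓤) :
    ∃ W : ι → Set X, (∀ i, IsOpen (W i)) ∧ (∀ i, W i ⊆ 𝓤 i) ∧ Z ⊆ ⋃ i, W i ∧
      Pairwise (Function.onFun Disjoint W) := by
  rcases isEmpty_or_nonempty X with hX | hX
  · exact ⟨fun _ => ∅, by simp, by simp, by simp [Z.eq_empty_of_isEmpty], fun _ _ _ => by simp⟩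
  have hloc : ∀ x, ∃ V ∈ 𝓝 x, (IsOpen V ∧ Disjoint (frontier V) Z) ∧ ∃ i, V ⊆ 𝓤 i := by
    intro x
    obtain ⟨i, hi⟩ := mem_iUnion.1 (h𝓤.2 ▸ mem_univ x)
    obtain ⟨V, hV, hxV, hVU⟩ := hZ.exists_subset_of_mem_open hi (h𝓤.1 i)
    exact ⟨V, hV.1.mem_nhds hxV, hV, i, hVU⟩
  obtain ⟨V, hV, hcov⟩ := exists_seq_cover hloc
  choose hV c hc using hV
  refine ⟨colorPart V c, isOpen_colorPart (fun k => (hV k).1) c, fun i x hx => ?_, fun x hx => ?_,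
    fun i j hij => disjoint_colorPart V c hij⟩
  · obtain ⟨k, rfl, hxk, -⟩ := mem_colorPart.1 hx
    exact hc k hxk
  · refine mem_iUnion.2 ((mem_colorPart_or_mem_frontier c hcov x).resolve_right ?_)
    rintro ⟨k, hk⟩
    exact disjoint_left.1 (hV k).2 hk hx

theorem multiplyCovered_comp_equiv {X : Type*} (m : ℕ) (𝓥 : ι → Set X) (e : κ ≃ ι) :
    multiplyCovered m (𝓥 ∘ e) = multiplyCovered m 𝓥 := by
  ext x
  change (m : ℕ∞) ≤ (e ⁻¹' {i | x ∈ 𝓥 i}).encard ↔ _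
  rw [encard_preimage_of_bijective e.bijective]
  rfl

theorem multiplyCovered_sumElim_subset {X : Type*} (m : ℕ) (𝓥 : ι → Set X) (𝓦 : κ → Set X) :
    multiplyCovered m (Sum.elim 𝓥 𝓦) ⊆ multiplyCovered m 𝓥 ∪ ⋃ k, 𝓦 k := by
  refine fun x hx => or_iff_not_imp_right.2 fun hx𝓦 => ?_
  have heq : {j | x ∈ Sum.elim 𝓥 𝓦 j} = Sum.inl '' {i | x ∈ 𝓥 i} := by
    ext (i | k)
    · simp
    · simpa using fun hk => hx𝓦 (mem_iUnion.2 ⟨k, hk⟩)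
  rwa [multiplyCovered, mem_ofPred_eq, heq, Sum.inl_injective.encard_image] at hx

theorem multiplyCovered_eq_empty_of_pairwise_disjoint {X : Type*} {n : ℕ} {W : Fin n → ι → Set X}
    (hW : ∀ i, Pairwise (Function.onFun Disjoint (W i))) :
    multiplyCovered (n + 1) (fun p : Fin n × ι => W p.1 p.2) = ∅ := by
  refine eq_empty_of_forall_notMem fun x hx => ?_
  have hinj : InjOn Prod.fst {p : Fin n × ι | x ∈ W p.1 p.2} := by
    rintro ⟨i, j⟩ hj ⟨_, k⟩ hk rfl
    by_contra hne
    exact disjoint_left.1 (hW i fun hjk : j = k => hne (by rw [hjk])) hj hk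
  have hle : {p : Fin n × ι | x ∈ W p.1 p.2}.encard ≤ n := by
    rw [← hinj.encard_image]
    exact (encard_le_encard (subset_univ _)).trans_eq (by simp)
  exact absurd (Nat.cast_le.1 (hx.trans hle)) (by simp)

theorem IsZeroDimUnion.exists_refinement {X : Type*} [TopologicalSpace X] [LindelofSpace X] {n : ℕ}
    {S : Set X} (h : IsZeroDimUnion n S) {𝓤 : ι → Set X} (h𝓤 : IsOpenCoverFamily 𝓤) :
    ∃ W : Fin n × ι → Set X, (∀ p, IsOpen (W p)) ∧ (∀ p, W p ⊆ 𝓤 p.2) ∧ S ⊆ ⋃ p, W p ∧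
      multiplyCovered (n + 1) W = ∅ := by
  obtain ⟨Z, hZ, hSZ⟩ := h
  choose W hW hWU hZW hdisj using fun i => (hZ i).exists_disjoint_refinement h𝓤
  refine ⟨fun p => W p.1 p.2, fun p => hW _ _, fun p => hWU _ _, ?_,
    multiplyCovered_eq_empty_of_pairwise_disjoint hdisj⟩
  rw [iUnion_prod']
  exact hSZ.trans (iUnion_mono hZW)

theorem IsOpenCoverFamily.comp_equiv {X : Type*} [TopologicalSpace X] {𝓥 : ι → Set X}
    (h : IsOpenCoverFamily 𝓥) (e : κ ≃ ι) : IsOpenCoverFamily (𝓥 ∘ e) :=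
  ⟨fun j => h.1 (e j), (e.surjective.iUnion_comp 𝓥).trans h.2⟩

/-- The condition of the covering characterization at `d = n + t`: every finite open cover has, for
each `ε > 0`, a finite open refinement whose points of multiplicity greater than `n` have
`(t + ε)`-content at most `ε`. -/
def HasThinRefinements (n : ℕ) (t : ℝ) (X : Type*) [MetricSpace X] : Prop :=
  ∀ ε : ℝ, 0 < ε → ∀ (k : ℕ) (𝓤 : Fin k → Set X), IsOpenCoverFamily 𝓤 →
    ∃ (l : ℕ) (𝓥 : Fin l → Set X), IsOpenCoverFamily 𝓥 ∧ (∀ j, ∃ i, 𝓥 j ⊆ 𝓤 i) ∧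
      hausdorffContent (t + ε) (multiplyCovered (n + 1) 𝓥) ≤ ENNReal.ofReal ε

theorem HasDimDecomposition.hasThinRefinements {X : Type*} [MetricSpace X]
    [SecondCountableTopology X] {n : ℕ} {t : NNReal} (h : HasDimDecomposition n t X) :
    HasThinRefinements n t X := by
  intro ε hε k 𝓤 h𝓤
  obtain ⟨A, hA, h⟩ := h
  have hs : 0 < t + ε := by positivity
  have hA0 : contentMeasure X (t + ε) A = 0 := by
    rw [contentMeasure_apply hs]
    refine hausdorffContent_eq_zero_of_dimH_lt (hA.trans_lt ?_)
    rw [← ENNReal.ofReal_coe_nnreal]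
    exact (ENNReal.ofReal_lt_ofReal_iff hs).2 (lt_add_of_pos_right _ hε)
  obtain ⟨G, hG, hAG, hμG⟩ := openRegular_contentMeasure hs A (ENNReal.ofReal ε) (by simpa using hε)
  obtain ⟨W, hW, hWU, hAW, hW0⟩ := h.exists_refinement h𝓤
  let 𝓥 : (Fin n × Fin k) ⊕ Fin k → Set X := Sum.elim W fun i => G ∩ 𝓤 i
  let e := (Fintype.equivFin ((Fin n × Fin k) ⊕ Fin k)).symm
  have hG_eq : ⋃ i, G ∩ 𝓤 i = G := by rw [← inter_iUnion, h𝓤.2, inter_univ]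
  have h𝓥 : IsOpenCoverFamily 𝓥 := by
    refine ⟨Sum.rec hW fun i => hG.inter (h𝓤.1 i), ?_⟩
    rw [iUnion_sum]
    change (⋃ p, W p) ∪ ⋃ i, G ∩ 𝓤 i = univ
    rw [hG_eq, ← univ_subset_iff, ← compl_union_self A]
    exact union_subset_union hAW hAG
  have hle : ∀ p, ∃ i, 𝓥 p ⊆ 𝓤 i := Sum.rec (fun p => ⟨p.2, hWU p⟩) fun i => ⟨i, inter_subset_right⟩
  have hsub : multiplyCovered (n + 1) 𝓥 ⊆ G :=
    (multiplyCovered_sumElim_subset _ _ _).trans_eq (by rw [hW0, hG_eq, empty_union])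
  refine ⟨_, 𝓥 ∘ e, h𝓥.comp_equiv e, fun j => hle (e j), ?_⟩
  rw [multiplyCovered_comp_equiv, ← contentMeasure_apply hs]
  calc contentMeasure X (t + ε) (multiplyCovered (n + 1) 𝓥) ≤ contentMeasure X (t + ε) G :=
        measure_mono hsub
    _ ≤ ENNReal.ofReal ε := hμG.trans_eq (by rw [hA0, zero_add])

end Covers

section GeneralPosition

open Module

theorem affineSpan_image_finset_ne_top {k V ι : Type*} [DivisionRing k] [AddCommGroup V]
    [Module k V] (w : ι → V) {s : Finset ι} (hs : s.card ≤ finrank k V) :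
    affineSpan k (w '' s) ≠ ⊤ := by
  classical
  intro htop
  rcases hcard : s.card with _ | m
  · rw [Finset.card_eq_zero.1 hcard, Finset.coe_empty, image_empty,
      AffineSubspace.span_empty] at htop
    exact AffineSubspace.bot_ne_top k V V htop
  · have hle := finrank_vectorSpan_image_finset_le k w s hcard
    rw [Finset.coe_image, ← direction_affineSpan, htop, AffineSubspace.direction_top,
      finrank_top] at hle
    omega

theorem exists_mem_forall_notMem_affineSpan {E ι : Type*} [NormedAddCommGroup E] [NormedSpace ℝ E]
    [FiniteDimensional ℝ E] [Countable ι] (w : ι → E) {U : Set E} (hU : IsOpen U)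
    (hne : U.Nonempty) :
    ∃ t ∈ U, ∀ s : Finset ι, s.card ≤ finrank ℝ E → t ∉ affineSpan ℝ (w '' s) := by
  borelize E
  have hnull : Measure.addHaar (⋃ s ∈ {s : Finset ι | s.card ≤ finrank ℝ E},
      (affineSpan ℝ (w '' s) : Set E)) = 0 :=
    (measure_biUnion_null_iff (Set.to_countable _)).2 fun s hs =>
      Measure.addHaar_affineSubspace _ _ (affineSpan_image_finset_ne_top w hs)
  by_contra! hcon
  refine hU.measure_ne_zero Measure.addHaar hne (measure_mono_null (fun t ht => ?_) hnull)
  obtain ⟨s, hs, hts⟩ := hcon t ht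
  exact mem_iUnion₂.2 ⟨s, hs, hts⟩

variable {X : Type*} [TopologicalSpace X] {ι : Type*}

theorem IsOpenCoverFamily.exists_continuous_mem_convexHull [NormalSpace X] [Finite ι] {E : Type*}
    [AddCommGroup E] [Module ℝ E] [TopologicalSpace E] [ContinuousAdd E] [ContinuousSMul ℝ E]
    {𝓥 : ι → Set X} (h𝓥 : IsOpenCoverFamily 𝓥) (w : ι → E) :
    ∃ f : X → E, Continuous f ∧ ∀ x, f x ∈ convexHull ℝ (w '' {j | x ∈ 𝓥 j}) := by
  obtain ⟨φ, hφ⟩ := PartitionOfUnity.exists_isSubordinate_of_locallyFinite isClosed_univ 𝓥 h𝓥.1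
    (locallyFinite_of_finite 𝓥) h𝓥.2.ge
  refine ⟨fun x => ∑ᶠ j, φ j x • w j, hφ.continuous_finsum_smul h𝓥.1 fun _ => continuousOn_const,
    fun x => φ.finsum_smul_mem_convex (g := fun j _ => w j) (mem_univ x) (fun j hj => ?_)
      (convex_convexHull ℝ _)⟩
  exact subset_convexHull ℝ _ (mem_image_of_mem w (hφ j (subset_tsupport _ hj)))

theorem isPartitionBetween_setOf_eq {A B : Set X} {f : X → ℝ} (hf : Continuous f) {c : ℝ}
    (hA : ∀ x ∈ A, c < f x) (hB : ∀ x ∈ B, f x < c) : IsPartitionBetween A B {x | f x = c} := by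
  refine ⟨{x | c < f x}, {x | f x < c}, isOpen_lt continuous_const hf,
    isOpen_lt hf continuous_const, hA, hB, ?_, ?_⟩
  · exact eq_empty_of_forall_notMem fun x hx => lt_asymm (mem_ofPred.1 hx.1) hx.2
  · ext x
    simp [le_antisymm_iff]

/-- The cover maps to its nerve in `ℝⁿ`, vertices going to corners of the cube `[-1, 1]ⁿ`. The
partitions are the coordinate hyperplanes through a point of the cube that lies on no simplex of
dimension less than `n`. -/
theorem IsOpenCoverFamily.exists_isPartitionBetween_iInter_subset_multiplyCovered [NormalSpace X]
    [Finite ι] {n : ℕ} {A B : Fin n → Set X} {𝓥 : ι → Set X} (h𝓥 : IsOpenCoverFamily 𝓥)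
    (hAB : ∀ j i, Disjoint (𝓥 j) (A i) ∨ Disjoint (𝓥 j) (B i)) :
    ∃ L : Fin n → Set X, (∀ i, IsPartitionBetween (A i) (B i) (L i)) ∧
      ⋂ i, L i ⊆ multiplyCovered (n + 1) 𝓥 := by
  classical
  let w (j : ι) (i : Fin n) : ℝ := if Disjoint (𝓥 j) (A i) then -1 else 1
  obtain ⟨f, hf, hfw⟩ := h𝓥.exists_continuous_mem_convexHull w
  have hconst {x i c} (h : ∀ j, x ∈ 𝓥 j → w j i = c) : f x i = c :=
    convexHull_min (image_subset_iff.2 h : _ ⊆ {y : Fin n → ℝ | y i = c})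
      (convex_hyperplane (f := fun y : Fin n → ℝ => y i) ⟨fun _ _ => rfl, fun _ _ => rfl⟩ c) (hfw x)
  have hfA i x (hx : x ∈ A i) : f x i = 1 :=
    hconst fun j hj => if_neg fun h => disjoint_left.1 h hj hx
  have hfB i x (hx : x ∈ B i) : f x i = -1 :=
    hconst fun j hj => if_pos ((hAB j i).resolve_right fun h => disjoint_left.1 h hj hx)
  obtain ⟨c, hc, hcw⟩ := exists_mem_forall_notMem_affineSpan w
    (isOpen_set_pi finite_univ fun _ _ => isOpen_Ioo (a := (-1 : ℝ)) (b := 1))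
    ⟨0, fun _ _ => by simp⟩
  refine ⟨fun i => {x | f x i = c i}, fun i => isPartitionBetween_setOf_eq
    ((continuous_apply i).comp hf) (fun x hx => ?_) (fun x hx => ?_), fun x hx => ?_⟩
  · exact (hc i trivial).2.trans_eq (hfA i x hx).symm
  · exact (hfB i x hx).trans_lt (hc i trivial).1
  · have hfx : f x = c := funext fun i => mem_iInter.1 hx i
    have hS := toFinite {j | x ∈ 𝓥 j}
    by_contra hlt
    refine hcw hS.toFinset ?_ ?_
    · rw [multiplyCovered, mem_ofPred_eq, hS.encard_eq_coe_toFinset_card, Nat.cast_le] at hlt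
      rw [finrank_fin_fun]
      omega
    · rw [hS.coe_toFinset]
      exact convexHull_subset_affineSpan _ (hfx ▸ hfw x)

theorem exists_isOpenCoverFamily_forall_disjoint [Finite ι] {A B : ι → Set X}
    (hA : ∀ i, IsClosed (A i)) (hB : ∀ i, IsClosed (B i)) (hAB : ∀ i, Disjoint (A i) (B i)) :
    ∃ 𝓤 : (ι → Bool) → Set X, IsOpenCoverFamily 𝓤 ∧
      ∀ b i, Disjoint (𝓤 b) (A i) ∨ Disjoint (𝓤 b) (B i) := by
  classical
  refine ⟨fun b => ⋂ i, (bif b i then A i else B i)ᶜ, ⟨fun b => isOpen_iInter_of_finite fun i => ?_,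
    eq_univ_of_forall fun x => mem_iUnion.2 ⟨fun i => decide (x ∉ A i), mem_iInter.2 fun i => ?_⟩⟩,
    fun b i => ?_⟩
  · cases b i <;> simp [hA, hB]
  · by_cases hx : x ∈ A i
    · simpa [hx] using (hAB i).notMem_of_mem_left hx
    · simp [hx]
  · have hdisj : Disjoint (⋂ i, (bif b i then A i else B i)ᶜ) (bif b i then A i else B i) :=
      disjoint_compl_left.mono_left (iInter_subset _ i)
    cases hb : b i <;> simp only [hb, cond_true, cond_false] at hdisj
    exacts [.inr hdisj, .inl hdisj]

theorem HasThinRefinements.almostPartitionable {X : Type*} [MetricSpace X] {n : ℕ} {s t : ℝ}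
    (h : HasThinRefinements n t X) (ht : 0 ≤ t) (hts : t < s) :
    AlmostPartitionable n (contentMeasure X s) univ := by
  intro ε hε A B hA hB hAB
  obtain ⟨δ, hδ, hδε⟩ := ENNReal.lt_iff_exists_nnreal_btwn.1
    (lt_min (lt_min (pos_iff_ne_zero.2 hε) one_pos) (ENNReal.ofReal_pos.2 (sub_pos.2 hts)))
  obtain ⟨⟨hδε, hδ1⟩, hδs⟩ := by simpa only [lt_min_iff] using hδε
  have hδ : (0 : ℝ) < δ := by exact_mod_cast hδ
  have hδs : t + δ ≤ s := by
    have := (ENNReal.lt_ofReal_iff_toReal_lt ENNReal.coe_ne_top).1 hδs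
    linarith [ENNReal.coe_toReal δ]
  obtain ⟨𝓤, h𝓤, h𝓤AB⟩ := exists_isOpenCoverFamily_forall_disjoint hA hB hAB
  let e := (Fintype.equivFin (Fin n → Bool)).symm
  obtain ⟨l, 𝓥, h𝓥, hle, hcontent⟩ := h δ hδ _ _ (h𝓤.comp_equiv e)
  rw [ENNReal.ofReal_coe_nnreal] at hcontent
  obtain ⟨L, hL, hsub⟩ :=
    h𝓥.exists_isPartitionBetween_iInter_subset_multiplyCovered (A := A) (B := B) fun j i =>
      let ⟨b, hb⟩ := hle j
      (h𝓤AB (e b) i).imp (·.mono_left hb) (·.mono_left hb)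
  refine ⟨L, hL, ?_⟩
  calc contentMeasure X s (univ ∩ ⋂ i, L i)
      ≤ contentMeasure X s (multiplyCovered (n + 1) 𝓥) := by
        rw [univ_inter]
        exact measure_mono hsub
    _ = hausdorffContent s (multiplyCovered (n + 1) 𝓥) := contentMeasure_apply (ht.trans_lt hts) _
    _ ≤ hausdorffContent (t + δ) (multiplyCovered (n + 1) 𝓥) :=
        hausdorffContent_le_hausdorffContent (by positivity) hδs (hcontent.trans_lt hδ1)
    _ ≤ ε := hcontent.trans hδε.le

end GeneralPosition

section Partitions

variable {X : Type*} [MetricSpace X] {n : ℕ}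

theorem almostPartitionable_contentMeasure_of_dimH_le {s : ℝ} {t : ℝ≥0∞}
    (hts : t < ENNReal.ofReal s)
    (h : ∀ A B : Fin n → Set X, (∀ i, IsClosed (A i)) → (∀ i, IsClosed (B i)) →
      (∀ i, Disjoint (A i) (B i)) →
      ∃ L : Fin n → Set X, (∀ i, IsPartitionBetween (A i) (B i) (L i)) ∧ dimH (⋂ i, L i) ≤ t) :
    AlmostPartitionable n (contentMeasure X s) univ := by
  intro ε _ A B hA hB hAB
  obtain ⟨L, hL, hdim⟩ := h A B hA hB hAB
  refine ⟨L, hL, ?_⟩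
  rw [contentMeasure_apply (ENNReal.ofReal_pos.1 hts.pos), univ_inter,
    hausdorffContent_eq_zero_of_dimH_lt (hdim.trans_lt hts)]
  exact bot_le

theorem exists_isPartitionBetween_iInter_subset [SecondCountableTopology X] {S : Set X}
    (hS : HasSmallInductiveDimensionLT (Sᶜ : Set X) n) {A B : Fin n → Set X}
    (hA : ∀ i, IsClosed (A i)) (hB : ∀ i, IsClosed (B i)) (hAB : ∀ i, Disjoint (A i) (B i)) :
    ∃ L : Fin n → Set X, (∀ i, IsPartitionBetween (A i) (B i) (L i)) ∧ ⋂ i, L i ⊆ S := by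
  have h : AlmostPartitionable n (⊤ : OuterMeasure X) Sᶜ :=
    .of_subtype ((almostPartitionable_top_of_hasSmallInductiveDimensionLT hS).mono le_top)
  obtain ⟨L, hL, hμ⟩ := h 1 one_ne_zero A B hA hB hAB
  refine ⟨L, hL, fun x hx => ?_⟩
  by_contra hxS
  rw [OuterMeasure.top_apply (s := Sᶜ ∩ ⋂ i, L i) ⟨x, hxS, hx⟩] at hμ
  exact absurd hμ (by simp)

end Partitions

section Conclusion

variable {n : ℕ}

theorem topDim_le_sub_one_iff {X : Type*} [TopologicalSpace X] :
    topDim X ≤ (n : EReal) - 1 ↔ HasSmallInductiveDimensionLT X n := by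
  have hn : (n : EReal) - 1 = ((n - 1 : ℝ) : EReal) := by
    rw [EReal.coe_sub, EReal.coe_one, EReal.coe_natCast]
  rw [← smallInductiveDimension_lt_iff, topDim, hn]
  generalize smallInductiveDimension X = d
  induction d with
  | bot =>
    refine iff_of_true ?_ (WithBot.bot_lt_coe _)
    exact EReal.coe_le_coe_iff.2 (by linarith [n.cast_nonneg (α := ℝ)] : (-1 : ℝ) ≤ n - 1)
  | coe k =>
    change ((k : ℝ≥0∞) : EReal) ≤ ((n - 1 : ℝ) : EReal) ↔ _
    induction k with
    | top => simpa using EReal.coe_ne_top (n - 1 : ℝ)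
    | coe m =>
      have hm : (((m : ℕ∞) : ℝ≥0∞) : EReal) = ((m : ℝ) : EReal) := by
        rw [ENat.toENNReal_coe, ← ENNReal.coe_natCast, EReal.coe_nnreal_eq_coe_real,
          NNReal.coe_natCast]
      rw [hm, EReal.coe_le_coe_iff, le_sub_iff_add_le]
      norm_cast

theorem hasSmallInductiveDimensionLT_of_indTopHausdorffDim_lt {X : Type*} [MetricSpace X]
    (h : indTopHausdorffDim n X < n) : HasSmallInductiveDimensionLT X n := by
  induction n generalizing X with
  | zero =>
    rw [hasSmallInductiveDimensionLT_zero_iff, ← univ_eq_empty_iff]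
    by_contra hX
    rw [indTopHausdorffDim, hausdorffDim, if_neg hX, Nat.cast_zero] at h
    exact absurd h (EReal.coe_ennreal_nonneg _).not_gt
  | succ n ih =>
    rw [indTopHausdorffDim] at h
    split_ifs at h with hX
    · infer_instance
    obtain ⟨d, ⟨𝓤, h𝓤, hd⟩, hdn⟩ := sInf_lt_iff.1 h
    have hlt : d - 1 < n := EReal.sub_lt_of_lt_add (by rwa [← Nat.cast_succ])
    exact .succ n 𝓤 h𝓤 fun U hU => ih ((hd U hU).trans_lt hlt)

theorem not_hasSmallInductiveDimensionLT_of_natCast_le_topDim {X : Type*} [TopologicalSpace X]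
    (h : n ≤ topDim X) : ¬ HasSmallInductiveDimensionLT X n := by
  rw [← topDim_le_sub_one_iff, not_le]
  refine lt_of_lt_of_le ?_ h
  exact EReal.coe_lt_coe_iff.2 (sub_one_lt (n : ℝ))

theorem nonempty_of_natCast_le_topDim {X : Type*} [TopologicalSpace X] (h : n ≤ topDim X) :
    Nonempty X := by
  by_contra hX
  rw [not_nonempty_iff] at hX
  exact not_hasSmallInductiveDimensionLT_of_natCast_le_topDim h inferInstance

theorem natCast_le_indTopHausdorffDim {X : Type*} [MetricSpace X] (h : n ≤ topDim X) :
    n ≤ indTopHausdorffDim n X :=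
  not_lt.1 fun hlt => not_hasSmallInductiveDimensionLT_of_natCast_le_topDim h
    (hasSmallInductiveDimensionLT_of_indTopHausdorffDim_lt hlt)

theorem indTopHausdorffDim_le_of_mem_paramTop {X : Type*} [MetricSpace X] [Nonempty X] (hn : 1 ≤ n)
    {d : EReal} (h : d ∈ paramTop n X) : indTopHausdorffDim n X ≤ d := by
  obtain ⟨m, rfl⟩ := Nat.exists_eq_add_of_le' hn
  rcases h with rfl | h
  · exact le_top
  · rw [indTopHausdorffDim, if_neg (not_isEmpty_of_nonempty X)]
    exact sInf_le h

theorem exists_eq_natCast_add {d : EReal} (h : n ≤ d) : ∃ t : ℝ≥0∞, d = n + (t : EReal) := by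
  have hnonneg : 0 ≤ d - n :=
    (EReal.sub_nonneg (.inr (EReal.natCast_ne_top n)) (.inr (EReal.natCast_ne_bot n))).2 h
  refine ⟨(d - n).toENNReal, ?_⟩
  rw [EReal.coe_toENNReal hnonneg, add_comm]
  exact EReal.sub_add_cancel.symm

theorem natCast_add_coe_ennreal_sub (n : ℕ) (t : ℝ≥0∞) : (n + t : EReal) - n = t :=
  EReal.add_sub_cancel_left (b := n)

theorem natCast_le_natCast_add (n : ℕ) (t : ℝ≥0∞) : (n : EReal) ≤ n + (t : EReal) :=
  le_add_of_nonneg_right (EReal.coe_ennreal_nonneg t)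

variable {X : Type*} [MetricSpace X] [SecondCountableTopology X] {t : ℝ≥0∞}

theorem indTopHausdorffDim_le_iff :
    indTopHausdorffDim n X ≤ n + (t : EReal) ↔ HasDimDecomposition n t X := by
  refine ⟨fun h => .of_almostPartitionable fun s hs => ?_, fun h => h.indTopHausdorffDim_le⟩
  refine almostPartitionable_contentMeasure_of_indTopHausdorffDim_lt
    (ENNReal.ofReal_pos.1 hs.pos) (h.trans_lt ?_)
  exact EReal.add_lt_add_left_coe (EReal.coe_ennreal_lt_coe_ennreal_iff.2 hs) n

theorem natCast_add_mem_paramTop_iff [Nonempty X] (hn : 1 ≤ n) :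
    n + (t : EReal) ∈ paramTop n X ↔ HasDimDecomposition n t X := by
  refine ⟨fun h => indTopHausdorffDim_le_iff.1 (indTopHausdorffDim_le_of_mem_paramTop hn h),
    fun h => .inr ?_⟩
  obtain ⟨m, rfl⟩ := Nat.exists_eq_add_of_le' hn
  obtain ⟨𝓤, h𝓤, h⟩ := h.exists_isTopologicalBasis
  refine ⟨𝓤, h𝓤, fun U hU => (h U hU).indTopHausdorffDim_le.trans_eq ?_⟩
  rw [Nat.cast_succ, add_right_comm]
  exact (EReal.add_sub_cancel_right (b := 1)).symm

theorem natCast_add_mem_paramPart_iff :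
    n + (t : EReal) ∈ paramPart n X ↔ HasDimDecomposition n t X := by
  simp only [paramPart, mem_ofPred_eq, natCast_add_coe_ennreal_sub, hausdorffDim_le_coe_iff,
    ← disjoint_iff_inter_eq_empty]
  constructor
  · rintro (htop | ⟨-, h⟩)
    · exact indTopHausdorffDim_le_iff.1 (le_top.trans_eq htop.symm)
    · exact .of_almostPartitionable fun s hs => almostPartitionable_contentMeasure_of_dimH_le hs h
  · rintro ⟨S, hS, h⟩
    refine .inr ⟨natCast_le_natCast_add n t, fun A B hA hB hAB => ?_⟩
    obtain ⟨L, hL, hLS⟩ := exists_isPartitionBetween_iInter_subset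
      h.hasSmallInductiveDimensionLT hA hB hAB
    exact ⟨L, hL, (dimH_mono hLS).trans hS⟩

theorem natCast_add_mem_paramDecomp_iff :
    n + (t : EReal) ∈ paramDecomp n X ↔ HasDimDecomposition n t X := by
  simp only [paramDecomp, mem_ofPred_eq, natCast_add_coe_ennreal_sub, hausdorffDim_le_coe_iff,
    topDim_le_sub_one_iff]
  constructor
  · rintro (htop | ⟨-, S, hS, hSc⟩)
    · exact indTopHausdorffDim_le_iff.1 (le_top.trans_eq htop.symm)
    · refine .of_almostPartitionable fun s hs =>
        almostPartitionable_contentMeasure_of_dimH_le hs fun A B hA hB hAB => ?_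
      obtain ⟨L, hL, hLS⟩ := exists_isPartitionBetween_iInter_subset hSc hA hB hAB
      exact ⟨L, hL, (dimH_mono hLS).trans hS⟩
  · rintro ⟨S, hS, h⟩
    exact .inr ⟨natCast_le_natCast_add n t, S, hS, h.hasSmallInductiveDimensionLT⟩

theorem natCast_add_mem_paramCover_iff :
    n + (t : EReal) ∈ paramCover n X ↔ HasDimDecomposition n t X := by
  constructor
  · rintro (htop | ⟨r, hr, hnr, h⟩)
    · exact indTopHausdorffDim_le_iff.1 (le_top.trans_eq htop.symm)
    · have ht : t = ENNReal.ofReal (r - n) := by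
        rw [← EReal.coe_ennreal_eq_coe_ennreal_iff, ← natCast_add_coe_ennreal_sub n, hr,
          EReal.coe_ennreal_ofReal, max_eq_left (sub_nonneg.2 hnr), EReal.coe_sub,
          EReal.coe_natCast]
      refine .of_almostPartitionable fun s hs =>
        HasThinRefinements.almostPartitionable h (sub_nonneg.2 hnr) ?_
      rw [ht] at hs
      exact (ENNReal.ofReal_lt_ofReal_iff (ENNReal.ofReal_pos.1 hs.pos)).1 hs
  · intro h
    induction t with
    | top => exact .inl (EReal.coe_add_top n)
    | coe t =>
      refine .inr ⟨n + t, rfl, le_add_of_nonneg_right t.coe_nonneg, ?_⟩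
      rw [add_sub_cancel_left]
      exact h.hasThinRefinements

theorem isLeast_of_forall_natCast_add_mem_iff {P : Set EReal} {D : EReal} (hD : n ≤ D)
    (hP : ∀ d ∈ P, (n : EReal) ≤ d) (h : ∀ t : ℝ≥0∞, n + (t : EReal) ∈ P ↔ D ≤ n + t) :
    IsLeast P D := by
  constructor
  · obtain ⟨t, rfl⟩ := exists_eq_natCast_add hD
    exact (h t).2 le_rfl
  · intro d hd
    obtain ⟨t, rfl⟩ := exists_eq_natCast_add (hP d hd)
    exact (h t).1 hd

end Conclusion

theorem theorem4p3 (n : ℕ) (hn : 1 ≤ n) (X : Type u) [MetricSpace X] [SeparableSpace X]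
    (hX : (n : EReal) ≤ topDim X) :
    IsLeast (paramTop n X) (indTopHausdorffDim n X) ∧
    IsLeast (paramDecomp n X) (indTopHausdorffDim n X) ∧
    IsLeast (paramPart n X) (indTopHausdorffDim n X) ∧
    IsLeast (paramCover n X) (indTopHausdorffDim n X) := by
  have : SecondCountableTopology X := UniformSpace.secondCountable_of_separable X
  have : Nonempty X := nonempty_of_natCast_le_topDim hX
  have hnD : n ≤ indTopHausdorffDim n X := natCast_le_indTopHausdorffDim hX
  have hleast {P : Set EReal} (hP : ∀ d ∈ P, (n : EReal) ≤ d)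
      (h : ∀ t : ℝ≥0∞, n + (t : EReal) ∈ P ↔ HasDimDecomposition n t X) :
      IsLeast P (indTopHausdorffDim n X) :=
    isLeast_of_forall_natCast_add_mem_iff hnD hP fun t => (h t).trans indTopHausdorffDim_le_iff.symm
  refine ⟨hleast ?_ fun t => natCast_add_mem_paramTop_iff hn,
    hleast ?_ fun t => natCast_add_mem_paramDecomp_iff,
    hleast ?_ fun t => natCast_add_mem_paramPart_iff,
    hleast ?_ fun t => natCast_add_mem_paramCover_iff⟩
  · exact fun d hd => hnD.trans (indTopHausdorffDim_le_of_mem_paramTop hn hd)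
  · rintro d (rfl | ⟨h, -⟩)
    exacts [le_top, h]
  · rintro d (rfl | ⟨h, -⟩)
    exacts [le_top, h]
  · rintro d (rfl | ⟨r, rfl, h, -⟩)
    exacts [le_top, EReal.coe_le_coe_iff.2 h]
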